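/- For a scheme $X$ of finite type over $\mathbb Z$ let $[X]$ denote the function $q\mapsto \#X(\mathbb F_q)$ on the set of prime powers $q=p^n$, $n\ge 1$. Let $\mathcal S\subset\mathbb Z[q]$ be the saturated multiplicative system generated by the polynomials $q^n-q$ for $n>1$ (saturated: every divisor in $\mathbb Z[q]$ of an element of $\mathcal S$ is in $\mathcal S$); its elements are regarded as functions on prime powers by evaluation. For a finite set $V$, a partially defined rank function for $V$ is a function $\pi:W\to\mathbb N$, where $W=\operatorname{dom}(\pi)$ is a set of subsets of $V$. For $s\in\mathbb N$ let $L(s,\pi)$ be the scheme over $\mathbb Z$ of all maps $f:V\to\mathbb A^s_{\mathbb Z}$ such that $f|_H$ has rank $\pi(H)$ for every $H\in W$; that is, the locally closed subscheme of $\mathbb A^{V\times s}_{\mathbb Z}=\operatorname{Spec}\mathbb Z[y_{vj}]_{v\in V,\,1\le j\le s}$ on which, for every $H\in W$, all $(\pi(H)+1)\times(\pi(H)+1)$ minors of the matrix $(y_{vj})_{v\in H,\,1\le j\le s}$ vanish and at least one of its $\pi(H)\times\pi(H)$ minors is invertible. For a field $K$, $L(s,\pi)(K)$ is the set of maps $f:V\to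 K^s$ with $\dim\operatorname{span} f(H)=\pi(H)$ for all $H\in W$. Theorem (Mnëv, Sturmfels). Let $X$ be a quasi-projective scheme of finite type over $\mathbb Z$. Then there are a finite set $V$, a partially defined rank function $\pi$ for $V$, and an element $\sigma\in\mathcal S$ such that $$\sigma\,[X]=[L(3,\pi)],$$ that is, $\sigma(q)\cdot\#X(\mathbb F_q)=\#L(3,\pi)(\mathbb F_q)$ for every prime power $q$. -/

import Mathlib

noncomputable section

open AlgebraicGeometry CategoryTheory

namespace MnevSturmfels

/-! ### Point counts -/

/-- The set of prime powers `p ^ n`, `n ≥ 1`. -/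
abbrev PrimePower : Type := {q : ℕ // IsPrimePow q}

instance (q : PrimePower) : Fact (Nat.minFac q.1).Prime :=
  ⟨Nat.minFac_prime q.2.ne_one⟩

/-- The field with `q` elements, for a prime power `q`: the Galois field of order `p ^ n`, where
`p` is the only prime divisor of `q` and `n` its multiplicity. -/
abbrev FF (q : PrimePower) : Type :=
  GaloisField (Nat.minFac q.1) (q.1.factorization (Nat.minFac q.1))

theorem card_FF (q : PrimePower) : Nat.card (FF q) = q.1 := by
  rw [GaloisField.card _ _ ?_, q.2.minFac_pow_factorization_eq]
  intro h
  have := q.2.minFac_pow_factorization_eq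
  rw [h, pow_zero] at this
  exact q.2.ne_one this.symm

/-- The function `[X] : q ↦ #X(𝔽_q)` on prime powers. As `Spec ℤ` is terminal, every morphism
`Spec 𝔽_q ⟶ X` is a morphism over `ℤ`. -/
def pointCount (X : Scheme.{0}) (q : PrimePower) : ℤ :=
  (Nat.card (Spec (.of (FF q)) ⟶ X) : ℤ)

/-- A polynomial in `ℤ[q]`, regarded as a function on prime powers. -/
def polyFun (σ : Polynomial ℤ) (q : PrimePower) : ℤ :=
  σ.eval (q.1 : ℤ)

/-- The saturated multiplicative system in `ℤ[q]` generated by the `q ^ n - q`, `n > 1`. -/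
def calS : SaturatedSubmonoid (Polynomial ℤ) :=
  (Submonoid.closure
    {f : Polynomial ℤ | ∃ n : ℕ, 1 < n ∧ f = Polynomial.X ^ n - Polynomial.X}).saturation

/-! ### Quasi-projective schemes of finite type over `ℤ` -/

/-- Projective `n`-space over `ℤ`, that is `Proj ℤ[x₀, …, xₙ]` with the usual grading. -/
def projectiveSpace (n : ℕ) : Scheme.{0} :=
  letI := MvPolynomial.gradedAlgebra (σ := Fin (n + 1)) (R := ℤ)
  Proj (MvPolynomial.homogeneousSubmodule (Fin (n + 1)) ℤ)

/-- `X` is of finite type over `ℤ`. -/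
def IsFiniteTypeOverInt (X : Scheme.{0}) : Prop :=
  LocallyOfFiniteType (specZIsTerminal.from X) ∧ QuasiCompact (specZIsTerminal.from X)

/-- `X` is quasi-projective over `ℤ`: it is a (locally closed) subscheme of a projective space. -/
def IsQuasiProjectiveOverInt (X : Scheme.{0}) : Prop :=
  ∃ (n : ℕ) (i : X ⟶ projectiveSpace n), IsImmersion i

/-! ### The schemes `L(s, π)` -/

/-- A partially defined rank function for `V`: a set `dom` of subsets of the finite set `V` and a
function `dom → ℕ`. -/
structure PartialRankFunction (V : Type) where
  dom : Finset (Finset V)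
  rank : dom → ℕ

variable {V : Type}

/-- The coordinate ring `ℤ[y_{vj}]` of the affine space `Fun(V, 𝒪^s)` of maps from `V` to affine
`s`-space over `ℤ`. -/
abbrev FunRing (V : Type) (s : ℕ) : Type := MvPolynomial (V × Fin s) ℤ

/-- The universal map from `V` to affine `s`-space, as a matrix of variables whose row `v` is the
image of `v`. -/
def universalMap (V : Type) (s : ℕ) : Matrix V (Fin s) (FunRing V s) :=
  Matrix.of fun v j => MvPolynomial.X (v, j)

/-- The `k × k` minors of the restriction of the universal map to `H`. Rows and columns are chosen
by arbitrary functions: compared with increasing choices, this adds only `0` and sign changes. -/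
def minor (s : ℕ) (H : Finset V) (k : ℕ) (a : Fin k → H) (b : Fin k → Fin s) : FunRing V s :=
  ((universalMap V s).submatrix (fun i => (a i : V)) b).det

/-- The ideal generated, for all `H` in the domain of `π`, by the `(π(H) + 1) × (π(H) + 1)` minors
of the restriction of the universal map to `H`. -/
def rankIdeal (s : ℕ) (π : PartialRankFunction V) : Ideal (FunRing V s) :=
  ⨆ H : π.dom, Ideal.span {m | ∃ a b, m = minor s H.1 (π.rank H + 1) a b}

/-- The closed subscheme of `Fun(V, 𝒪^s)` of the maps whose restriction to each `H` in the domain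
of `π` has rank at most `π(H)`. -/
abbrev LClosed (s : ℕ) (π : PartialRankFunction V) : Scheme.{0} :=
  Spec (.of (FunRing V s ⧸ rankIdeal s π))

/-- The open subset of `LClosed s π` where, for each `H` in the domain of `π`, at least one
`π(H) × π(H)` minor of the restriction to `H` is invertible. -/
def LOpen (s : ℕ) (π : PartialRankFunction V) :
    TopologicalSpace.Opens (PrimeSpectrum (FunRing V s ⧸ rankIdeal s π)) :=
  Finset.univ.inf fun H : π.dom =>
    ⨆ (a : Fin (π.rank H) → H.1) (b : Fin (π.rank H) → Fin s),
      PrimeSpectrum.basicOpen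
        (Ideal.Quotient.mk (rankIdeal s π) (minor s H.1 (π.rank H) a b))

/-- `L(s, π)`: the scheme of all maps from `V` to affine `s`-space over `ℤ` whose restriction to
each `H` in the domain of `π` has rank `π(H)`. It is a locally closed subscheme of `Fun(V, 𝒪^s)`. -/
def L (s : ℕ) (π : PartialRankFunction V) : Scheme.{0} :=
  Scheme.Opens.toScheme (X := LClosed s π) (LOpen s π)

end MnevSturmfels

end

/-!
For a field `K`, the `K`-valued points of a quotient of `ℤ[x₁, …, xₙ]` are the solutions in `K` of
an arithmetic system, whose equations only say `t = 0`, `t = 1`, `t = t' + t''` or `t = t' * t''`: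
the unknowns stand for the variables and for all intermediate results in the evaluation of the
relations. Any scheme of finite type can be treated in this way, because it is cut into finitely
many affine pieces `U ∩ Z`, with `U` affine open and `Z` closed, and the points of a disjoint
union of affine schemes with values in a field are those of the spectrum of the product ring.

Relative to a projective frame of the plane, the affine points `(tᵢ, tⱼ)` and von Staudt's
constructions turn such a system into conditions on triples of points to be collinear or not, that
is, into a partial rank function. A map `V → K³` with these ranks is moved by exactly one linear
automorphism, up to the scaling of the vectors, to the standard position of a solution, so that
there are `#GL₃(K) · (#K - 1)^(#V - 1)` of them for each solution. For `q = #K` the factor is the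
value of the polynomial `(q³ - 1)(q³ - q)(q³ - q²)(q - 1)^(#V - 1)`, which lies in `𝒮`.
-/

noncomputable section

open AlgebraicGeometry CategoryTheory

namespace MnevSturmfels

/-! ### Field-valued points -/

section Points

universe u

variable {K : Type u} [Field K] {X Y : Scheme.{u}}

/-- The point of the underlying space of `X` at which a `K`-valued point of `X` is located. -/
def imagePoint (g : Spec (.of K) ⟶ X) : X :=
  g (⊥ : PrimeSpectrum K)

theorem imagePoint_comp (g : Spec (.of K) ⟶ X) (f : X ⟶ Y) :
    imagePoint (g ≫ f) = f (imagePoint g) := rfl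

theorem range_eq_singleton_imagePoint (g : Spec (.of K) ⟶ X) : Set.range g = {imagePoint g} := by
  ext x
  refine ⟨?_, fun h => h ▸ ⟨_, rfl⟩⟩
  rintro ⟨y, rfl⟩
  exact congrArg g (Subsingleton.elim (α := PrimeSpectrum K) y ⊥)

/-- The `K`-valued points of the source of an open immersion, as the `K`-valued points of the
target that are located in its image. -/
def openImmersionPointsEquiv (j : Y ⟶ X) [IsOpenImmersion j] :
    (Spec (.of K) ⟶ Y) ≃ {g : Spec (.of K) ⟶ X // imagePoint g ∈ j.opensRange} where
  toFun g := ⟨g ≫ j, imagePoint g, rfl⟩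
  invFun g := IsOpenImmersion.lift j g.1 (by
    rw [range_eq_singleton_imagePoint, Set.singleton_subset_iff]; exact g.2)
  left_inv g := (IsOpenImmersion.lift_uniq j _ _ g rfl).symm
  right_inv g := Subtype.ext (IsOpenImmersion.lift_fac j g.1 _)

/-- The `K`-valued points of an affine scheme, as ring homomorphisms. -/
def specPointsEquiv (A : CommRingCat.{u}) : (Spec (.of K) ⟶ Spec A) ≃ (A →+* K) :=
  Spec.homEquiv.trans
    ⟨fun φ => φ.hom, fun φ => CommRingCat.ofHom φ, fun _ => rfl, fun _ => rfl⟩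

theorem imagePoint_specPointsEquiv_symm (A : CommRingCat.{u}) (φ : A →+* K) :
    imagePoint ((specPointsEquiv A).symm φ) = PrimeSpectrum.comap φ ⊥ := rfl

end Points

section RingHoms

variable {A B C K : Type*} [CommRing A] [CommRing B] [CommRing C] [CommRing K]

/-- Homomorphisms out of a quotient ring, as homomorphisms that kill the ideal. -/
def quotientRingHomEquiv (I : Ideal A) : (A ⧸ I →+* K) ≃ {φ : A →+* K // I ≤ RingHom.ker φ} where
  toFun ψ := ⟨ψ.comp (Ideal.Quotient.mk I), fun a ha => by
    simp [RingHom.mem_ker, Ideal.Quotient.eq_zero_iff_mem.mpr ha]⟩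
  invFun φ := Ideal.Quotient.lift I φ.1 fun _ ha => φ.2 ha
  left_inv ψ := Ideal.Quotient.ringHom_ext (RingHom.ext fun _ => rfl)
  right_inv φ := Subtype.ext (RingHom.ext fun _ => rfl)

theorem exists_comp_fst_eq {φ : B × C →+* K} (h : φ (0, 1) = 0) :
    ∃ ψ : B →+* K, ψ.comp (RingHom.fst B C) = φ := by
  have hker : RingHom.ker (RingHom.fst B C) ≤ RingHom.ker φ := by
    rintro ⟨_, c⟩ rfl
    simpa [h] using map_mul φ (0, c) (0, 1)
  exact ⟨(RingHom.fst B C).liftOfSurjective Prod.fst_surjective ⟨φ, hker⟩,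
    RingHom.liftOfRightInverse_comp ..⟩

theorem exists_comp_snd_eq {φ : B × C →+* K} (h : φ (1, 0) = 0) :
    ∃ ψ : C →+* K, ψ.comp (RingHom.snd B C) = φ := by
  obtain ⟨ψ, hψ⟩ := exists_comp_fst_eq (B := C) (C := B)
    (φ := φ.comp (RingEquiv.prodComm : C × B ≃+* B × C).toRingHom) h
  exact ⟨ψ, RingHom.ext fun x => RingHom.congr_fun hψ x.swap⟩

variable (B C K) in
/-- Homomorphisms from a product of two rings to a domain, as homomorphisms from one of the two
factors. -/
def prodRingHomEquiv [IsDomain K] : (B →+* K) ⊕ (C →+* K) ≃ (B × C →+* K) :=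
  Equiv.ofBijective
    (Sum.elim (fun φ => φ.comp (RingHom.fst B C)) (fun φ => φ.comp (RingHom.snd B C))) <| by
      refine ⟨Function.Injective.sumElim ?_ ?_ fun φ ψ h => ?_, fun φ => ?_⟩
      · exact fun φ ψ => (RingHom.cancel_right Prod.fst_surjective).mp
      · exact fun φ ψ => (RingHom.cancel_right Prod.snd_surjective).mp
      · simpa using RingHom.congr_fun h (1, 0)
      · have h : φ (1, 0) * φ (0, 1) = 0 := by
          rw [← map_mul, Prod.mk_mul_mk, mul_zero, zero_mul]
          exact map_zero φ
        rcases mul_eq_zero.mp h with h | h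
        · exact (exists_comp_snd_eq h).elim fun ψ hψ => ⟨.inr ψ, hψ⟩
        · exact (exists_comp_fst_eq h).elim fun ψ hψ => ⟨.inl ψ, hψ⟩

end RingHoms

/-! ### Reduction to affine schemes -/

section Affine

variable {X : Scheme.{0}}

/-- The points of `X` located in `Z`, with values in any field, are those of an affine scheme of
finite type over `ℤ`. The bijections need not come from a morphism of schemes, so that `Z` may be
cut into pieces. -/
def HasAffinePoints (Z : Set X) : Prop :=
  ∃ (B : Type) (_ : CommRing B), Algebra.FiniteType ℤ B ∧ ∀ (K : Type) [Field K],
    Nonempty ({g : Spec (.of K) ⟶ X // imagePoint g ∈ Z} ≃ (B →+* K))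

theorem HasAffinePoints.empty : HasAffinePoints (∅ : Set X) := by
  refine ⟨PUnit, inferInstance, inferInstance, fun K _ => ⟨?_⟩⟩
  have : IsEmpty (PUnit →+* K) :=
    ⟨fun φ => zero_ne_one (α := K) (by rw [← map_zero φ, ← map_one φ])⟩
  have : IsEmpty {g : Spec (.of K) ⟶ X // imagePoint g ∈ (∅ : Set X)} := ⟨fun g => g.2⟩
  exact Equiv.equivOfIsEmpty _ _

open Classical in
theorem HasAffinePoints.union {Z Z' : Set X} (hZ : HasAffinePoints Z) (hZ' : HasAffinePoints Z')
    (hd : Disjoint Z Z') : HasAffinePoints (Z ∪ Z') := by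
  obtain ⟨B, _, _, hB⟩ := hZ
  obtain ⟨C, _, _, hC⟩ := hZ'
  refine ⟨B × C, inferInstance, by convert! Algebra.FiniteType.prod (R := ℤ) (A := B) (B := C),
    fun K _ => ?_⟩
  obtain ⟨e⟩ := hB K
  obtain ⟨e'⟩ := hC K
  have hd' : Disjoint (fun g : Spec (.of K) ⟶ X => imagePoint g ∈ Z) (imagePoint · ∈ Z') :=
    hd.preimage imagePoint
  exact ⟨(subtypeOrEquiv _ _ hd').trans ((e.sumCongr e').trans (prodRingHomEquiv B C K))⟩

theorem finiteType_int_of_isAffineOpen [LocallyOfFiniteType (specZIsTerminal.from X)] {U : X.Opens}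
    (hU : IsAffineOpen U) : Algebra.FiniteType ℤ Γ(X, U) := by
  have h := (Scheme.Hom.finiteType_appLE (specZIsTerminal.from X) (isAffineOpen_top _) hU
    le_top).comp (RingHom.FiniteType.of_surjective ((Scheme.ΓSpecIso (.of ℤ)).inv.hom)
      (ConcreteCategory.bijective_of_isIso (Scheme.ΓSpecIso (.of ℤ)).inv).2)
  rw [RingHom.ext_int (RingHom.comp _ _) (algebraMap ℤ Γ(X, U))] at h
  exact RingHom.finiteType_algebraMap.mp h

theorem HasAffinePoints.inter_of_isAffineOpen {U : X.Opens} (hU : IsAffineOpen U)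
    [Algebra.FiniteType ℤ Γ(X, U)] {Z : Set X} (hZ : IsClosed Z) :
    HasAffinePoints ((U : Set X) ∩ Z) := by
  obtain ⟨I, hI⟩ := (PrimeSpectrum.isClosed_iff_zeroLocus_ideal _).mp
    (hZ.preimage hU.fromSpec.continuous)
  refine ⟨Γ(X, U) ⧸ I, inferInstance, .of_surjective (Ideal.Quotient.mk I).toIntAlgHom
    Ideal.Quotient.mk_surjective, fun K _ => ⟨?_⟩⟩
  let e : (Γ(X, U) →+* K) ≃ {g : Spec (.of K) ⟶ X // imagePoint g ∈ hU.fromSpec.opensRange} :=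
    (specPointsEquiv Γ(X, U)).symm.trans (openImmersionPointsEquiv hU.fromSpec)
  have he (φ : Γ(X, U) →+* K) : I ≤ RingHom.ker φ ↔ imagePoint (e φ).1 ∈ Z := by
    have h : imagePoint (e φ).1 = hU.fromSpec (PrimeSpectrum.comap φ ⊥) := by
      change imagePoint (_ ≫ _) = _
      rw [imagePoint_comp, imagePoint_specPointsEquiv_symm]
    rw [h]
    change _ ↔ PrimeSpectrum.comap φ ⊥ ∈ hU.fromSpec ⁻¹' Z
    rw [hI]
    rfl
  calc {g : Spec (.of K) ⟶ X // imagePoint g ∈ (U : Set X) ∩ Z}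
    _ ≃ {g : Spec (.of K) ⟶ X // imagePoint g ∈ hU.fromSpec.opensRange ∧ imagePoint g ∈ Z} :=
      Equiv.subtypeEquivRight fun g => by rw [hU.opensRange_fromSpec]; rfl
    _ ≃ _ := (Equiv.subtypeSubtypeEquivSubtypeInter _ (imagePoint · ∈ Z)).symm
    _ ≃ {φ : Γ(X, U) →+* K // I ≤ RingHom.ker φ} := (e.subtypeEquiv he).symm
    _ ≃ (Γ(X, U) ⧸ I →+* K) := (quotientRingHomEquiv I).symm

theorem hasAffinePoints_univ (hX : IsFiniteTypeOverInt X) :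
    HasAffinePoints (Set.univ : Set X) := by
  have := hX.1
  have := hX.2
  have : CompactSpace X := QuasiCompact.compactSpace_of_compactSpace (specZIsTerminal.from X)
  refine compact_open_induction_on (P := fun W : X.Opens => HasAffinePoints (W : Set X)) ⊤
    isCompact_univ .empty fun W _ U hW => ?_
  have := finiteType_int_of_isAffineOpen U.2
  have hUW := HasAffinePoints.inter_of_isAffineOpen U.2 W.isOpen.isClosed_compl
  convert hW.union hUW (Set.disjoint_left.mpr fun x hx hx' => hx'.2 hx) using 1
  simp [← Set.sdiff_eq]

theorem exists_finiteType_ring_points (hX : IsFiniteTypeOverInt X) :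
    ∃ (B : Type) (_ : CommRing B), Algebra.FiniteType ℤ B ∧ ∀ (K : Type) [Field K],
      Nonempty ((Spec (.of K) ⟶ X) ≃ (B →+* K)) := by
  obtain ⟨B, hB, hB', h⟩ := hasAffinePoints_univ hX
  exact ⟨B, hB, hB', fun K _ =>
    (h K).map (Equiv.subtypeUnivEquiv fun _ => Set.mem_univ _).symm.trans⟩

end Affine

/-! ### Elementary arithmetic systems -/

section Rigid

variable {R B K : Type} [CommRing R] [CommRing B] [CommRing K] {J J' : Set R}

/-- `t` respects the ring operations of `R` as far as these do not lead out of `J`. -/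
structure IsPartialHom (J : Set R) (t : R → K) : Prop where
  zero : t 0 = 0
  one : t 1 = 1
  add : ∀ {a b}, a ∈ J → b ∈ J → a + b ∈ J → t (a + b) = t a + t b
  mul : ∀ {a b}, a ∈ J → b ∈ J → a * b ∈ J → t (a * b) = t a * t b

theorem IsPartialHom.mono {t : R → K} (ht : IsPartialHom J' t) (h : J ⊆ J') :
    IsPartialHom J t :=
  ⟨ht.zero, ht.one, fun ha hb hab => ht.add (h ha) (h hb) (h hab),
    fun ha hb hab => ht.mul (h ha) (h hb) (h hab)⟩

theorem IsPartialHom.comp {f : R →+* B} {t : B → K} (ht : IsPartialHom (f '' J) t) :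
    IsPartialHom J (t ∘ f) where
  zero := by simp [ht.zero]
  one := by simp [ht.one]
  add ha hb hab := by
    simpa using ht.add ⟨_, ha, rfl⟩ ⟨_, hb, rfl⟩ ⟨_, hab, map_add f _ _⟩
  mul ha hb hab := by
    simpa using ht.mul ⟨_, ha, rfl⟩ ⟨_, hb, rfl⟩ ⟨_, hab, map_mul f _ _⟩

/-- `J` is rigid if every partial homomorphism on `J` is the restriction of a homomorphism. -/
def IsRigid (J : Set R) : Prop :=
  ∀ (K : Type) [CommRing K] (t : R → K), IsPartialHom J t → ∃ φ : R →+* K, J.EqOn t φ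

theorem isRigid_range_X (σ : Type) :
    IsRigid (Set.range (MvPolynomial.X : σ → MvPolynomial σ ℤ)) := by
  intro K _ t _
  refine ⟨MvPolynomial.eval₂Hom (Int.castRingHom K) fun i => t (.X i), ?_⟩
  rintro _ ⟨i, rfl⟩
  simp

theorem closure_range_X (σ : Type) :
    Subring.closure (Set.range (MvPolynomial.X : σ → MvPolynomial σ ℤ)) = ⊤ := by
  refine eq_top_iff.mpr fun p _ => ?_
  induction p using MvPolynomial.induction_on with
  | C a => exact eq_intCast (MvPolynomial.C (σ := σ)) a ▸ intCast_mem _ a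
  | add p q hp hq => exact add_mem (hp trivial) (hq trivial)
  | mul_X p i hp => exact mul_mem (hp trivial) (Subring.subset_closure ⟨i, rfl⟩)

theorem IsRigid.insert_of_forall_eq (hJ : IsRigid J) {p : R}
    (hp : ∀ (K : Type) [CommRing K] (t : R → K) (φ : R →+* K), IsPartialHom (insert p J) t →
      J.EqOn t φ → t p = φ p) : IsRigid (insert p J) := by
  intro K _ t ht
  obtain ⟨φ, hφ⟩ := hJ K t (ht.mono (Set.subset_insert p J))
  exact ⟨φ, Set.forall_mem_insert.mpr ⟨hp K t φ ht hφ, hφ⟩⟩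

theorem IsRigid.insert_zero (hJ : IsRigid J) : IsRigid (insert 0 J) :=
  hJ.insert_of_forall_eq fun _ _ _ φ ht _ => ht.zero.trans (map_zero φ).symm

theorem IsRigid.insert_one (hJ : IsRigid J) : IsRigid (insert 1 J) :=
  hJ.insert_of_forall_eq fun _ _ _ φ ht _ => ht.one.trans (map_one φ).symm

theorem IsRigid.insert_add (hJ : IsRigid J) {a b : R} (ha : a ∈ J) (hb : b ∈ J) :
    IsRigid (insert (a + b) J) :=
  hJ.insert_of_forall_eq fun _ _ t φ ht hφ => by
    rw [ht.add (.inr ha) (.inr hb) (.inl rfl), hφ ha, hφ hb, map_add]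

theorem IsRigid.insert_mul (hJ : IsRigid J) {a b : R} (ha : a ∈ J) (hb : b ∈ J) :
    IsRigid (insert (a * b) J) :=
  hJ.insert_of_forall_eq fun _ _ t φ ht hφ => by
    rw [ht.mul (.inr ha) (.inr hb) (.inl rfl), hφ ha, hφ hb, map_mul]

theorem IsRigid.insert_neg (hJ : IsRigid J) {a : R} (h0 : 0 ∈ J) (ha : a ∈ J) :
    IsRigid (insert (-a) J) :=
  hJ.insert_of_forall_eq fun _ _ t φ ht hφ => by
    have h : t (-a) + t a = 0 := by
      rw [← ht.add (.inl rfl) (.inr ha) (by simp [h0]), neg_add_cancel, ht.zero]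
    rw [map_neg, ← hφ ha, eq_neg_of_add_eq_zero_left h]

theorem IsRigid.exists_superset_mem (hJ : IsRigid J) (hfin : J.Finite) {p : R}
    (hp : p ∈ Subring.closure J) : ∃ J' ⊇ J, J'.Finite ∧ IsRigid J' ∧ p ∈ J' := by
  suffices ∀ J' ⊇ J, J'.Finite → IsRigid J' → ∃ J'' ⊇ J', J''.Finite ∧ IsRigid J'' ∧ p ∈ J'' from
    this J subset_rfl hfin hJ
  have insert_witness {J' J'' : Set R} {r : R} (h : J' ⊆ J'') (hfin : J''.Finite)
      (hr : IsRigid (insert r J'')) : ∃ J'' ⊇ J', J''.Finite ∧ IsRigid J'' ∧ r ∈ J'' :=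
    ⟨_, h.trans (Set.subset_insert r _), hfin.insert r, hr, Set.mem_insert r _⟩
  induction hp using Subring.closure_induction with
  | mem a ha => exact fun J' h hfin hr => ⟨J', subset_rfl, hfin, hr, h ha⟩
  | zero => exact fun J' _ hfin hr => insert_witness subset_rfl hfin hr.insert_zero
  | one => exact fun J' _ hfin hr => insert_witness subset_rfl hfin hr.insert_one
  | add a b _ _ iha ihb =>
    intro J₀ h₀ hfin₀ hr₀
    obtain ⟨J₁, h₁, hfin₁, hr₁, ha⟩ := iha J₀ h₀ hfin₀ hr₀
    obtain ⟨J₂, h₂, hfin₂, hr₂, hb⟩ := ihb J₁ (h₀.trans h₁) hfin₁ hr₁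
    exact insert_witness (h₁.trans h₂) hfin₂ (hr₂.insert_add (h₂ ha) hb)
  | neg a _ iha =>
    intro J₀ h₀ hfin₀ hr₀
    obtain ⟨J₁, h₁, hfin₁, hr₁, ha⟩ := iha J₀ h₀ hfin₀ hr₀
    exact insert_witness (h₁.trans (Set.subset_insert 0 _)) (hfin₁.insert 0)
      (hr₁.insert_zero.insert_neg (.inl rfl) (.inr ha))
  | mul a b _ _ iha ihb =>
    intro J₀ h₀ hfin₀ hr₀
    obtain ⟨J₁, h₁, hfin₁, hr₁, ha⟩ := iha J₀ h₀ hfin₀ hr₀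
    obtain ⟨J₂, h₂, hfin₂, hr₂, hb⟩ := ihb J₁ (h₀.trans h₁) hfin₁ hr₁
    exact insert_witness (h₁.trans h₂) hfin₂ (hr₂.insert_mul (h₂ ha) hb)

theorem IsRigid.exists_superset (hJ : IsRigid J) (hfin : J.Finite) {T : Set R} (hT : T.Finite)
    (hTJ : T ⊆ Subring.closure J) : ∃ J' ⊇ J, J'.Finite ∧ IsRigid J' ∧ T ⊆ J' := by
  induction T, hT using Set.Finite.induction_on with
  | empty => exact ⟨J, subset_rfl, hfin, hJ, Set.empty_subset J⟩
  | @insert a T _ _ ih =>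
    obtain ⟨J₁, h₁, hfin₁, hr₁, hT₁⟩ := ih ((Set.subset_insert a T).trans hTJ)
    obtain ⟨J₂, h₂, hfin₂, hr₂, ha⟩ :=
      hr₁.exists_superset_mem hfin₁ (Subring.closure_mono h₁ (hTJ (Set.mem_insert a T)))
    exact ⟨J₂, h₁.trans h₂, hfin₂, hr₂, Set.insert_subset ha (hT₁.trans h₂)⟩

theorem IsRigid.image (hJ : IsRigid J) {f : R →+* B} (hf : Function.Surjective f) {G : Set R}
    (hker : RingHom.ker f = Ideal.span G) (hG : G ⊆ J) : IsRigid (f '' J) := by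
  intro K _ t ht
  obtain ⟨φ, hφ⟩ := hJ K (t ∘ f) ht.comp
  have hle : RingHom.ker f ≤ RingHom.ker φ := by
    rw [hker, Ideal.span_le]
    intro g hg
    have hg' : f g = 0 := RingHom.mem_ker.mp (hker ▸ Ideal.subset_span hg)
    simp [RingHom.mem_ker, ← hφ (hG hg), hg', ht.zero]
  refine ⟨f.liftOfSurjective hf ⟨φ, hle⟩, ?_⟩
  rintro _ ⟨a, ha, rfl⟩
  rw [RingHom.liftOfSurjective, RingHom.liftOfRightInverse_comp_apply]
  exact hφ ha

theorem exists_finite_isRigid (B : Type) [CommRing B] [Algebra.FiniteType ℤ B] :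
    ∃ I : Set B, I.Finite ∧ 0 ∈ I ∧ 1 ∈ I ∧ Subring.closure I = ⊤ ∧ IsRigid I := by
  obtain ⟨n, f, hf⟩ := Algebra.FiniteType.iff_quotient_mvPolynomial''.mp
    (inferInstance : Algebra.FiniteType ℤ B)
  obtain ⟨G, hG⟩ : (RingHom.ker f.toRingHom).FG := IsNoetherian.noetherian _
  have hX := closure_range_X (Fin n)
  obtain ⟨J, hXJ, hfin, hJ, hGJ⟩ := (isRigid_range_X (Fin n)).exists_superset (Set.finite_range _)
    ((G.finite_toSet.insert 1).insert 0) (by simp [hX])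
  refine ⟨f.toRingHom '' J, hfin.image _, ⟨0, hGJ (by simp), map_zero _⟩,
    ⟨1, hGJ (by simp), map_one _⟩, ?_, hJ.image hf hG.symm fun g hg => hGJ (by simp [hg])⟩
  rw [← RingHom.map_closure, top_unique (hX.ge.trans (Subring.closure_mono hXJ)),
    ← RingHom.range_eq_map, RingHom.range_eq_top]
  exact hf

end Rigid

/-- A system of equations of the forms `t = 0`, `t = 1`, `t = t' + t''`, `t = t' * t''` in the
unknowns `ι`. -/
structure ArithSystem (ι : Type) where
  zero : ι
  one : ι
  add : ι → ι → ι → Prop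
  mul : ι → ι → ι → Prop

namespace ArithSystem

variable {ι B K : Type} [CommRing B] [CommRing K]

/-- `t` solves the arithmetic system `S`. -/
structure IsSolution (S : ArithSystem ι) (t : ι → K) : Prop where
  zero : t S.zero = 0
  one : t S.one = 1
  add : ∀ {i j k}, S.add i j k → t k = t i + t j
  mul : ∀ {i j k}, S.mul i j k → t k = t i * t j

/-- The arithmetic system of all relations of the allowed forms that hold between the elements of
`I`, with these elements as unknowns. -/
def ofSet (I : Set B) (h0 : 0 ∈ I) (h1 : 1 ∈ I) : ArithSystem I where
  zero := ⟨0, h0⟩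
  one := ⟨1, h1⟩
  add i j k := (i : B) + j = k
  mul i j k := (i : B) * j = k

variable {I : Set B} {h0 : 0 ∈ I} {h1 : 1 ∈ I}

theorem isSolution_ofSet_domRestrict (φ : B →+* K) :
    (ofSet I h0 h1).IsSolution (I.domRestrict φ) where
  zero := map_zero φ
  one := map_one φ
  add h := (congrArg φ h.symm).trans (map_add φ _ _)
  mul h := (congrArg φ h.symm).trans (map_mul φ _ _)

theorem IsSolution.isPartialHom_extend {t : I → K} (ht : (ofSet I h0 h1).IsSolution t) :
    IsPartialHom I (Function.extend Subtype.val t 0) := by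
  have hext (i : I) : Function.extend Subtype.val t 0 (i : B) = t i :=
    Subtype.val_injective.extend_apply t 0 i
  refine ⟨(hext _).trans ht.zero, (hext _).trans ht.one, fun {a b} ha hb hab => ?_,
    fun {a b} ha hb hab => ?_⟩
  · rw [hext ⟨a, ha⟩, hext ⟨b, hb⟩, hext ⟨a + b, hab⟩]
    exact ht.add rfl
  · rw [hext ⟨a, ha⟩, hext ⟨b, hb⟩, hext ⟨a * b, hab⟩]
    exact ht.mul rfl

theorem bijective_domRestrict_ofSet (hI : Subring.closure I = ⊤) (hrig : IsRigid I) :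
    Function.Bijective fun φ : B →+* K => (⟨I.domRestrict φ, isSolution_ofSet_domRestrict φ⟩ :
      {t // (ofSet I h0 h1).IsSolution t}) := by
  refine ⟨fun φ ψ h => ?_, fun ⟨t, ht⟩ => ?_⟩
  · exact RingHom.eq_of_eqOn_set_dense hI
      (Set.domRestrict_eq_domRestrict_iff.mp (congrArg Subtype.val h))
  · obtain ⟨φ, hφ⟩ := hrig K _ ht.isPartialHom_extend
    refine ⟨φ, Subtype.ext (funext fun i => ?_)⟩
    exact (hφ i.2).symm.trans (Subtype.val_injective.extend_apply t 0 i)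

end ArithSystem

theorem exists_arithSystem (B : Type) [CommRing B] [Algebra.FiniteType ℤ B] :
    ∃ (ι : Type) (_ : Finite ι) (S : ArithSystem ι), ∀ (K : Type) [CommRing K],
      Nonempty ((B →+* K) ≃ {t : ι → K // S.IsSolution t}) := by
  obtain ⟨I, hfin, h0, h1, hI, hrig⟩ := exists_finite_isRigid B
  exact ⟨I, hfin.to_subtype, .ofSet I h0 h1, fun K _ =>
    ⟨Equiv.ofBijective _ (ArithSystem.bijective_domRestrict_ofSet hI hrig)⟩⟩

/-! ### Rank and minors -/

section Minors

variable {K M m n : Type*} [Field K] [AddCommGroup M] [Module K M] [Finite m]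

theorem exists_linearIndependent_comp_of_le_finrank (v : m → M) {k : ℕ}
    (hk : k ≤ (Set.range v).finrank K) : ∃ a : Fin k → m, LinearIndependent K (v ∘ a) := by
  have := Module.Finite.span_of_finite K (Set.finite_range v)
  obtain ⟨w, hw, -, hli⟩ := Submodule.exists_fun_fin_finrank_span_eq K (Set.range v)
  choose a ha using hw
  refine ⟨a ∘ Fin.castLE hk, ?_⟩
  have hva : v ∘ a ∘ Fin.castLE hk = w ∘ Fin.castLE hk := funext fun i => ha _
  exact hva ▸ hli.comp _ (Fin.castLE_injective hk)

theorem exists_det_submatrix_ne_zero_iff [Fintype n] (A : Matrix m n K) (k : ℕ) :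
    (∃ (a : Fin k → m) (b : Fin k → n), (A.submatrix a b).det ≠ 0) ↔ k ≤ A.rank := by
  constructor
  · rintro ⟨a, b, h⟩
    simpa [Matrix.rank_of_det_ne_zero h] using A.rank_submatrix_le a b
  · intro hk
    rw [Matrix.rank_eq_finrank_span_row] at hk
    obtain ⟨a, ha⟩ := exists_linearIndependent_comp_of_le_finrank A.row hk
    have hr : (A.submatrix a id).rank = k := by
      simpa using LinearIndependent.rank_matrix (M := A.submatrix a id) ha
    rw [Matrix.rank_eq_finrank_span_cols] at hr
    obtain ⟨b, hb⟩ := exists_linearIndependent_comp_of_le_finrank (A.submatrix a id).col hr.ge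
    have hab : IsUnit (A.submatrix a b) := Matrix.linearIndependent_cols_iff_isUnit.mp hb
    exact ⟨a, b, ((Matrix.isUnit_iff_isUnit_det _).mp hab).ne_zero⟩

theorem rank_eq_card_iff_det_ne_zero [Fintype n] [DecidableEq n] {A : Matrix n n K} :
    A.rank = Fintype.card n ↔ A.det ≠ 0 := by
  rw [← isUnit_iff_ne_zero, ← Matrix.isUnit_iff_isUnit_det,
    ← Matrix.linearIndependent_rows_iff_isUnit, linearIndependent_iff_card_eq_finrank_span,
    Set.finrank, ← Matrix.rank_eq_finrank_span_row, eq_comm]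

end Minors

/-! ### The points of `L(s, π)` -/

section Realizations

variable {K V : Type} [Field K] {s : ℕ}

/-- `f` has the ranks prescribed by `π`, that is, `f` is a `K`-valued point of `L s π`. -/
def Realizes (π : PartialRankFunction V) (f : V → Fin s → K) : Prop :=
  ∀ H : π.dom, (f '' (H : Finset V)).finrank K = π.rank H

variable (K V s) in
/-- The `K`-valued points of the affine space of maps from `V` to affine `s`-space. -/
def funRingHomEquiv : (FunRing V s →+* K) ≃ (V → Fin s → K) :=
  MvPolynomial.homEquiv.trans (Equiv.curry V (Fin s) K)

theorem finrank_image_eq_rank (f : V → Fin s → K) (H : Finset V) :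
    (f '' H).finrank K = ((Matrix.of f).submatrix ((↑) : H → V) id).rank := by
  have h : Set.range ((Matrix.of f).submatrix ((↑) : H → V) id).row = f '' H := by
    ext x
    exact ⟨fun ⟨v, hv⟩ => ⟨v, v.2, hv⟩, fun ⟨v, hv, hx⟩ => ⟨⟨v, hv⟩, hx⟩⟩
  rw [Matrix.rank_eq_finrank_span_row, h, Set.finrank]

theorem map_minor (φ : FunRing V s →+* K) (H : Finset V) (k : ℕ) (a : Fin k → H)
    (b : Fin k → Fin s) :
    φ (minor s H k a b) = (((Matrix.of (funRingHomEquiv K V s φ)).submatrix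
      ((↑) : H → V) id).submatrix a b).det := by
  rw [minor, RingHom.map_det]
  rfl

theorem le_finrank_image_iff (φ : FunRing V s →+* K) (H : Finset V) (k : ℕ) :
    k ≤ (funRingHomEquiv K V s φ '' H).finrank K ↔ ∃ a b, φ (minor s H k a b) ≠ 0 := by
  simp_rw [map_minor, exists_det_submatrix_ne_zero_iff, finrank_image_eq_rank]

theorem rankIdeal_le_ker_iff (π : PartialRankFunction V) (φ : FunRing V s →+* K) :
    rankIdeal s π ≤ RingHom.ker φ ↔
      ∀ H : π.dom, (funRingHomEquiv K V s φ '' (H : Finset V)).finrank K ≤ π.rank H := by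
  rw [rankIdeal, iSup_le_iff]
  refine forall_congr' fun H => ?_
  rw [Ideal.span_le, ← not_lt, ← Nat.add_one_le_iff, le_finrank_image_iff]
  push Not
  exact ⟨fun h a b => h ⟨a, b, rfl⟩, fun h _ ⟨a, b, hm⟩ => hm ▸ h a b⟩

theorem comap_mem_LOpen_iff (π : PartialRankFunction V) (ψ : FunRing V s ⧸ rankIdeal s π →+* K) :
    PrimeSpectrum.comap ψ ⊥ ∈ LOpen s π ↔ ∀ H : π.dom, π.rank H ≤
      (funRingHomEquiv K V s (ψ.comp (Ideal.Quotient.mk _)) '' (H : Finset V)).finrank K := by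
  rw [LOpen, ← SetLike.mem_coe, TopologicalSpace.Opens.coe_finset_inf]
  simp only [Finset.inf_eq_iInf, Finset.mem_univ, iInf_pos, Function.comp,
    Set.iInf_eq_iInter, Set.mem_iInter]
  refine forall_congr' fun H => ?_
  simp only [SetLike.mem_coe, TopologicalSpace.Opens.mem_iSup]
  rw [le_finrank_image_iff]
  exact exists_congr fun a => exists_congr fun b => Iff.rfl

variable (K) in
/-- The `K`-valued points of `L s π`, as the maps with the prescribed ranks. -/
def pointsLEquiv (s : ℕ) (π : PartialRankFunction V) :
    (Spec (.of K) ⟶ L s π) ≃ {f : V → Fin s → K // Realizes π f} :=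
  let U : (LClosed s π).Opens := LOpen s π
  let Q (φ : FunRing V s →+* K) : Prop :=
    ∀ H : π.dom, π.rank H ≤ (funRingHomEquiv K V s φ '' (H : Finset V)).finrank K
  calc (Spec (.of K) ⟶ L s π)
    _ ≃ {g : Spec (.of K) ⟶ LClosed s π // imagePoint g ∈ U.ι.opensRange} :=
      openImmersionPointsEquiv U.ι
    _ ≃ {ψ : FunRing V s ⧸ rankIdeal s π →+* K // PrimeSpectrum.comap ψ ⊥ ∈ LOpen s π} :=
      ((specPointsEquiv _).symm.subtypeEquiv fun ψ => by
        rw [Scheme.Opens.opensRange_ι]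
        exact Iff.rfl).symm
    _ ≃ {φ : {φ : FunRing V s →+* K // rankIdeal s π ≤ RingHom.ker φ} // Q φ.1} :=
      (quotientRingHomEquiv (rankIdeal s π)).subtypeEquiv (comap_mem_LOpen_iff π)
    _ ≃ {φ : FunRing V s →+* K // rankIdeal s π ≤ RingHom.ker φ ∧ Q φ} :=
      Equiv.subtypeSubtypeEquivSubtypeInter _ Q
    _ ≃ {f : V → Fin s → K // Realizes π f} :=
      (funRingHomEquiv K V s).subtypeEquiv fun φ => by
        rw [rankIdeal_le_ker_iff, ← forall_and]
        exact forall_congr' fun H => le_antisymm_iff.symm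

end Realizations

/-! ### Frames -/

theorem exists_linearEquiv_frame {K n : Type*} [Field K] [Fintype n] [DecidableEq n]
    {A : Matrix n n K} {u : n → K} (hA : A.det ≠ 0) (hu : ∀ i, (A.updateRow i u).det ≠ 0) :
    ∃ (g : (n → K) ≃ₗ[K] (n → K)) (a : n → K), (∀ i, g (A i) = Pi.single i (a i)) ∧ g u = 1 := by
  classical
  let b : Module.Basis n K (n → K) := basisOfPiSpaceOfLinearIndependent
    (Matrix.linearIndependent_rows_of_det_ne_zero hA)
  have hb (i : n) : b i = A i := congrFun (coe_basisOfPiSpaceOfLinearIndependent _) i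
  let w : n → K := b.equivFun u
  have hsum : u = ∑ k, w k • A k := by simp_rw [← hb, w, b.sum_equivFun]
  have hw (i : n) : w i ≠ 0 := by
    have := hu i
    rw [hsum, Matrix.det_updateRow_sum] at this
    exact left_ne_zero_of_mul this
  let b' : Module.Basis n K (n → K) := b.unitsSMul fun i => Units.mk0 (w i) (hw i)
  have hb' (i : n) : b' i = w i • A i := (b.unitsSMul_apply i).trans (congrArg (w i • ·) (hb i))
  have hg (i : n) : b'.equivFun (w i • A i) = Pi.single i 1 := by
    rw [← hb', b'.equivFun_apply, b'.repr_self, Finsupp.single_eq_pi_single]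
  refine ⟨b'.equivFun, fun i => (w i)⁻¹, fun i => ?_, ?_⟩
  · rw [← inv_smul_smul₀ (hw i) (A i), map_smul, hg, ← Pi.single_smul, smul_eq_mul, mul_one]
  · rw [hsum, map_sum]
    simp_rw [hg]
    exact Finset.univ_sum_single 1

theorem linearEquiv_ext_frame {K n M : Type*} [Field K] [Finite n] [DecidableEq n]
    [AddCommGroup M] [Module K M] {g g' : (n → K) ≃ₗ[K] M} (d : n → K)
    (h : ∀ i, g (Pi.single i 1) = d i • g' (Pi.single i 1)) (h1 : g 1 = g' 1) : g = g' := by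
  have hd : (g : (n → K) →ₗ[K] M) = g' ∘ₗ LinearMap.mulLeft K d :=
    LinearMap.pi_ext' fun i => LinearMap.ext_ring (by
      simp [h, ← map_smul, ← Pi.single_smul, ← Pi.single_mul_right])
  have hone : d = 1 := g'.injective <| by
    rw [← h1, ← g.coe_coe, hd]
    simp
  refine LinearEquiv.toLinearMap_injective (hd.trans ?_)
  rw [hone, LinearMap.mulLeft_one, LinearMap.comp_id]

section Transform

variable {K V M M' : Type*} [Field K] [AddCommGroup M] [Module K M] [AddCommGroup M'] [Module K M']

/-- The configuration obtained from `f` by a linear isomorphism and a rescaling of the vectors. -/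
def transform (g : M ≃ₗ[K] M') (c : V → Kˣ) (f : V → M) : V → M' :=
  fun v => c v • g (f v)

theorem span_transform_image (g : M ≃ₗ[K] M') (c : V → Kˣ) (f : V → M) (H : Set V) :
    Submodule.span K (transform g c f '' H) = (Submodule.span K (f '' H)).map (g : M →ₗ[K] M') := by
  rw [Submodule.map_span, Set.image_image]
  refine le_antisymm (Submodule.span_le.mpr ?_) (Submodule.span_le.mpr ?_) <;>
    rintro _ ⟨v, hv, rfl⟩
  · exact Submodule.smul_mem _ (c v : K) (Submodule.subset_span ⟨v, hv, rfl⟩)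
  · rw [SetLike.mem_coe, ← Submodule.smul_mem_iff' _ (c v)]
    exact Submodule.subset_span ⟨v, hv, rfl⟩

theorem finrank_transform_image (g : M ≃ₗ[K] M') (c : V → Kˣ) (f : V → M) (H : Set V) :
    (transform g c f '' H).finrank K = (f '' H).finrank K := by
  rw [Set.finrank, span_transform_image, LinearEquiv.finrank_map_eq, Set.finrank]

end Transform

theorem realizes_transform_iff {K V : Type} [Field K] {s : ℕ} {π : PartialRankFunction V}
    (g : (Fin s → K) ≃ₗ[K] (Fin s → K)) (c : V → Kˣ) {f : V → Fin s → K} :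
    Realizes π (transform g c f) ↔ Realizes π f := by
  simp only [Realizes, finrank_transform_image]

section Triples

variable {K V : Type*} [Field K]

open Classical in
/-- The set of the three given points. -/
def triple (u v w : V) : Finset V := {u, v, w}

theorem mem_triple {u v w x : V} : x ∈ triple u v w ↔ x = u ∨ x = v ∨ x = w := by
  simp [triple]

variable {n : ℕ} {f : V → Fin n → K} {u v w : V}

theorem finrank_image_triple (f : V → Fin n → K) (u v w : V) :
    (f '' (triple u v w : Finset V)).finrank K = (Matrix.of ![f u, f v, f w]).rank := by
  have h : Set.range (Matrix.of ![f u, f v, f w]).row = f '' (triple u v w : Finset V) := by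
    change Set.range ![f u, f v, f w] = _
    ext x
    simp [triple, Set.image_insert_eq, or_comm, or_left_comm]
  rw [Matrix.rank_eq_finrank_span_row, h, Set.finrank]

theorem finrank_image_triple_eq_three_iff {f : V → Fin 3 → K} :
    (f '' (triple u v w : Finset V)).finrank K = 3 ↔ (Matrix.of ![f u, f v, f w]).det ≠ 0 := by
  rw [finrank_image_triple, ← rank_eq_card_iff_det_ne_zero, Fintype.card_fin]

theorem finrank_image_triple_eq_two {f : V → Fin 3 → K} (i j : Fin 3)
    (hij : f u i * f v j - f u j * f v i ≠ 0) (h : (Matrix.of ![f u, f v, f w]).det = 0) :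
    (f '' (triple u v w : Finset V)).finrank K = 2 := by
  have hle : (f '' (triple u v w : Finset V)).finrank K ≤ 3 := by
    rw [finrank_image_triple]
    exact Matrix.rank_le_height _
  have hne : (f '' (triple u v w : Finset V)).finrank K ≠ 3 :=
    fun h3 => finrank_image_triple_eq_three_iff.mp h3 h
  have hge : 2 ≤ (f '' (triple u v w : Finset V)).finrank K := by
    rw [finrank_image_triple, ← exists_det_submatrix_ne_zero_iff]
    exact ⟨![0, 1], ![i, j], by rwa [Matrix.det_fin_two]⟩
  omega

end Triples

/-! ### The configuration of an arithmetic system -/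

/-- The points of the projective plane that encode an arithmetic system in the unknowns `ι`: the
points at infinity of the axes and of the diagonal, the origin `(0, 0)`, the point `(1, 1)` and, for
a solution `t`, the points `(t i, t j)`. -/
inductive Vertex (ι : Type) : Type
  | infX
  | infY
  | origin
  | unit
  | infD
  | point (i j : ι)

section Configuration

open Vertex

variable {ι K : Type} [Field K]

instance [Finite ι] : Finite (Vertex ι) := by
  refine Finite.of_surjective (α := Fin 5 ⊕ ι × ι)
    (Sum.elim ![infX, infY, origin, unit, infD] fun p => point p.1 p.2) ?_
  rintro (_ | _ | _ | _ | _ | ⟨i, j⟩)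
  exacts [⟨.inl 0, rfl⟩, ⟨.inl 1, rfl⟩, ⟨.inl 2, rfl⟩, ⟨.inl 3, rfl⟩, ⟨.inl 4, rfl⟩,
    ⟨.inr (i, j), rfl⟩]

/-- The triples of points required not to be collinear: the first four make `infX, infY, origin,
unit` a projective frame, the last two put the other points on the intended side of infinity. -/
inductive IsFrame : Vertex ι → Vertex ι → Vertex ι → Prop
  | basis : IsFrame infX infY origin
  | unit_infY_origin : IsFrame unit infY origin
  | infX_unit_origin : IsFrame infX unit origin
  | infX_infY_unit : IsFrame infX infY unit
  | infX_origin_infD : IsFrame infX origin infD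
  | infX_infY_point (i j : ι) : IsFrame infX infY (point i j)

/-- The triples of points required to be collinear. The last two constructors are von Staudt's
constructions of the sum and of the product. -/
inductive IsLine (S : ArithSystem ι) : Vertex ι → Vertex ι → Vertex ι → Prop
  | infinity : IsLine S infX infY infD
  | diagonal_infD : IsLine S origin unit infD
  | diagonal (i : ι) : IsLine S origin unit (point i i)
  | vertical (i j : ι) : IsLine S infY (point i i) (point i j)
  | horizontal (i j : ι) : IsLine S infX (point j j) (point i j)
  | zero : IsLine S infX origin (point S.zero S.zero)
  | one : IsLine S infY unit (point S.one S.one)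
  | add {i j k : ι} (h : S.add i j k) : IsLine S infD (point k i) (point j S.zero)
  | mul {i j k : ι} (h : S.mul i j k) : IsLine S origin (point S.one i) (point j k)

theorem IsFrame.triple_ne {S : ArithSystem ι} {u v w u' v' w' : Vertex ι} (h : IsFrame u v w)
    (h' : IsLine S u' v' w') : triple u v w ≠ triple u' v' w' := by
  intro he
  have hX := Finset.ext_iff.mp he infX
  have hY := Finset.ext_iff.mp he infY
  have hO := Finset.ext_iff.mp he origin
  have hU := Finset.ext_iff.mp he unit
  have hD := Finset.ext_iff.mp he infD
  simp only [mem_triple] at hX hY hO hU hD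
  cases h <;> cases h' <;> simp_all

open Classical in
/-- The partial rank function that forces the triples `IsFrame` to have rank three and the triples
`IsLine` to have rank two. -/
def ArithSystem.rankFunction [Finite ι] (S : ArithSystem ι) : PartialRankFunction (Vertex ι) where
  dom := letI := Fintype.ofFinite (Vertex ι)
    Finset.univ.filter fun H => ∃ u v w, (IsFrame u v w ∨ IsLine S u v w) ∧ H = triple u v w
  rank H := if ∃ u v w, IsFrame u v w ∧ H.1 = triple u v w then 3 else 2

theorem ArithSystem.realizes_rankFunction_iff [Finite ι] (S : ArithSystem ι)
    {f : Vertex ι → Fin 3 → K} :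
    Realizes S.rankFunction f ↔
      (∀ u v w, IsFrame u v w → (f '' (triple u v w : Finset (Vertex ι))).finrank K = 3) ∧
      ∀ u v w, IsLine S u v w → (f '' (triple u v w : Finset (Vertex ι))).finrank K = 2 := by
  have hframe {u v w : Vertex ι} (h : IsFrame u v w) :
      ∃ u' v' w', IsFrame u' v' w' ∧ triple u v w = triple u' v' w' := ⟨u, v, w, h, rfl⟩
  have hline {u v w : Vertex ι} (h : IsLine S u v w) :
      ¬ ∃ u' v' w', IsFrame u' v' w' ∧ triple u v w = triple u' v' w' :=
    fun ⟨_, _, _, h', he⟩ => h'.triple_ne h he.symm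
  constructor
  · refine fun hf => ⟨fun u v w h => ?_, fun u v w h => ?_⟩
    · exact (hf ⟨triple u v w, by simpa [rankFunction] using ⟨u, v, w, .inl h, rfl⟩⟩).trans
        (if_pos (hframe h))
    · exact (hf ⟨triple u v w, by simpa [rankFunction] using ⟨u, v, w, .inr h, rfl⟩⟩).trans
        (if_neg (hline h))
  · rintro ⟨hF, hL⟩ ⟨H, hH⟩
    obtain ⟨u, v, w, h | h, rfl⟩ : ∃ u v w, (IsFrame u v w ∨ IsLine S u v w) ∧
        H = triple u v w := by simpa [rankFunction] using hH
    · exact (hF u v w h).trans (if_pos (hframe h)).symm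
    · exact (hL u v w h).trans (if_neg (hline h)).symm

variable {S : ArithSystem ι}

theorem Realizes.det_ne_zero [Finite ι] {f : Vertex ι → Fin 3 → K}
    (hf : Realizes S.rankFunction f) {u v w : Vertex ι} (h : IsFrame u v w) :
    (Matrix.of ![f u, f v, f w]).det ≠ 0 :=
  finrank_image_triple_eq_three_iff.mp ((S.realizes_rankFunction_iff.mp hf).1 u v w h)

theorem Realizes.det_eq_zero [Finite ι] {f : Vertex ι → Fin 3 → K}
    (hf : Realizes S.rankFunction f) {u v w : Vertex ι} (h : IsLine S u v w) :
    (Matrix.of ![f u, f v, f w]).det = 0 := by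
  by_contra hne
  have h3 := finrank_image_triple_eq_three_iff.mpr hne
  have h2 := (S.realizes_rankFunction_iff.mp hf).2 u v w h
  omega

/-- The configuration, in homogeneous coordinates, of a family `t` of scalars. -/
def std (t : ι → K) : Vertex ι → Fin 3 → K
  | infX => ![1, 0, 0]
  | infY => ![0, 1, 0]
  | origin => ![0, 0, 1]
  | unit => ![1, 1, 1]
  | infD => ![1, 1, 0]
  | point i j => ![t i, t j, 1]

theorem IsFrame.det_std_ne_zero {u v w : Vertex ι} (h : IsFrame u v w) (t : ι → K) :
    (Matrix.of ![std t u, std t v, std t w]).det ≠ 0 := by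
  cases h <;> simp [std, Matrix.det_fin_three]

theorem IsLine.finrank_std_eq_two {t : ι → K} (ht : S.IsSolution t) {u v w : Vertex ι}
    (h : IsLine S u v w) : (std t '' (triple u v w : Finset (Vertex ι))).finrank K = 2 := by
  cases h with
  | infinity =>
    exact finrank_image_triple_eq_two 0 1 (by simp [std]) (by simp [std, Matrix.det_fin_three])
  | diagonal_infD | diagonal i | horizontal i j =>
    exact finrank_image_triple_eq_two 0 2 (by simp [std]) (by simp [std, Matrix.det_fin_three])
  | vertical i j =>
    exact finrank_image_triple_eq_two 1 2 (by simp [std]) (by simp [std, Matrix.det_fin_three])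
  | zero =>
    exact finrank_image_triple_eq_two 0 2 (by simp [std])
      (by simp [std, Matrix.det_fin_three, ht.zero])
  | one =>
    exact finrank_image_triple_eq_two 1 2 (by simp [std])
      (by simp [std, Matrix.det_fin_three, ht.one])
  | add h =>
    exact finrank_image_triple_eq_two 0 2 (by simp [std])
      (by simp [std, Matrix.det_fin_three, ht.zero, ht.add h])
  | mul h =>
    exact finrank_image_triple_eq_two 0 2 (by simp [std, ht.one])
      (by simp [std, Matrix.det_fin_three, ht.one, ht.mul h])

theorem Realizes.isSolution_of_std [Finite ι] {t : ι → K}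
    (h : Realizes S.rankFunction (std t)) : S.IsSolution t := by
  have hzero : t S.zero = 0 := by simpa [std, Matrix.det_fin_three] using h.det_eq_zero .zero
  have hone : t S.one = 1 := by
    have : -1 + t S.one = 0 := by simpa [std, Matrix.det_fin_three] using h.det_eq_zero .one
    linear_combination this
  refine ⟨hzero, hone, fun {i j k} hadd => ?_, fun {i j k} hmul => ?_⟩
  · have : t i - t k + t j = 0 := by
      simpa [std, Matrix.det_fin_three, hzero] using h.det_eq_zero (.add hadd)
    linear_combination -this
  · have : t k - t i * t j = 0 := by
      simpa [std, Matrix.det_fin_three, hone] using h.det_eq_zero (.mul hmul)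
    linear_combination this

theorem realizes_std_iff [Finite ι] {t : ι → K} :
    Realizes S.rankFunction (std t) ↔ S.IsSolution t :=
  ⟨Realizes.isSolution_of_std, fun ht => S.realizes_rankFunction_iff.mpr
    ⟨fun _ _ _ h => finrank_image_triple_eq_three_iff.mpr (h.det_std_ne_zero t),
      fun _ _ _ h => h.finrank_std_eq_two ht⟩⟩

end Configuration

/-! ### Parametrization of the realizations -/

section Parametrization

open Vertex

variable {ι K : Type} [Field K] {S : ArithSystem ι}

/-- The vertices that `std` places at the standard basis. -/
def basisVertex : Fin 3 → Vertex ι :=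
  ![infX, infY, origin]

/-- A coordinate at which the vectors of `std` equal `1`, used to fix their scaling. -/
def pivot : Vertex ι → Fin 3
  | infX | unit => 0
  | infY | infD => 1
  | origin | point _ _ => 2

theorem pivot_basisVertex (i : Fin 3) : pivot (basisVertex i : Vertex ι) = i := by
  fin_cases i <;> rfl

theorem std_basisVertex (t : ι → K) (i : Fin 3) : std t (basisVertex i) = Pi.single i 1 := by
  ext j
  fin_cases i <;> fin_cases j <;> rfl

theorem std_unit (t : ι → K) : std t unit = 1 := by
  ext j
  fin_cases j <;> rfl

theorem std_apply_pivot (t : ι → K) (v : Vertex ι) : std t v (pivot v) = 1 := by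
  cases v <;> rfl

theorem std_injective : Function.Injective (std : (ι → K) → Vertex ι → Fin 3 → K) :=
  fun _ _ h => funext fun i => congrFun (congrFun h (point i i)) 0

theorem transform_std_injective {g g' : (Fin 3 → K) ≃ₗ[K] (Fin 3 → K)} {c c' : Vertex ι → Kˣ}
    {t t' : ι → K} (hc : c unit = c' unit)
    (h : transform g c (std t) = transform g' c' (std t')) : g = g' ∧ c = c' ∧ t = t' := by
  have hv (v : Vertex ι) : c v • g (std t v) = c' v • g' (std t' v) := congrFun h v
  have hg : g = g' := by
    refine linearEquiv_ext_frame (fun i => ((c (basisVertex i))⁻¹ * c' (basisVertex i) : Kˣ))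
      (fun i => ?_) ?_
    · rw [← Units.smul_def, mul_smul, eq_inv_smul_iff, ← std_basisVertex t, hv,
        std_basisVertex, std_basisVertex]
    · have := hv unit
      rwa [hc, smul_left_cancel_iff, std_unit, std_unit] at this
  subst hg
  have hstd (v : Vertex ι) : c v • std t v = c' v • std t' v := g.injective <| by
    rw [Units.smul_def, Units.smul_def, map_smul, map_smul]
    exact hv v
  have hcc : c = c' := funext fun v => Units.ext <| by
    simpa [Units.smul_def, std_apply_pivot] using congrFun (hstd v) (pivot v)
  subst hcc
  exact ⟨rfl, rfl, std_injective (funext fun v => smul_left_cancel (c v) (hstd v))⟩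

variable [Finite ι] {f : Vertex ι → Fin 3 → K}

theorem Realizes.exists_linearEquiv_frame (hf : Realizes S.rankFunction f) :
    ∃ (g : (Fin 3 → K) ≃ₗ[K] (Fin 3 → K)) (a : Fin 3 → K),
      (∀ i, g (f (basisVertex i)) = Pi.single i (a i)) ∧ g (f unit) = 1 := by
  refine MnevSturmfels.exists_linearEquiv_frame (A := Matrix.of (f ∘ basisVertex)) ?_ fun i => ?_
  · convert hf.det_ne_zero .basis using 2
    ext i j
    fin_cases i <;> rfl
  · fin_cases i
    · convert hf.det_ne_zero .unit_infY_origin using 2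
      ext i j
      fin_cases i <;> rfl
    · convert hf.det_ne_zero .infX_unit_origin using 2
      ext i j
      fin_cases i <;> rfl
    · convert hf.det_ne_zero .infX_infY_unit using 2
      ext i j
      fin_cases i <;> rfl

theorem Realizes.apply_pivot_ne_zero (hf : Realizes S.rankFunction f) {a : Fin 3 → K}
    (hbasis : ∀ i, f (basisVertex i) = Pi.single i (a i)) (hunit : f unit = 1) (v : Vertex ι) :
    f v (pivot v) ≠ 0 := by
  have hX : f infX = ![a 0, 0, 0] := (hbasis 0).trans (by ext j; fin_cases j <;> rfl)
  have hY : f infY = ![0, a 1, 0] := (hbasis 1).trans (by ext j; fin_cases j <;> rfl)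
  have hO : f origin = ![0, 0, a 2] := (hbasis 2).trans (by ext j; fin_cases j <;> rfl)
  have ha : (a 0 ≠ 0 ∧ a 1 ≠ 0) ∧ a 2 ≠ 0 := by
    simpa [hX, hY, hO, Matrix.det_fin_three] using hf.det_ne_zero .basis
  cases v with
  | infX => simpa [hX, pivot] using ha.1.1
  | infY => simpa [hY, pivot] using ha.1.2
  | origin => simpa [hO, pivot] using ha.2
  | unit => simp [hunit]
  | infD =>
    have : (a 0 ≠ 0 ∧ a 2 ≠ 0) ∧ f infD 1 ≠ 0 := by
      simpa [hX, hO, Matrix.det_fin_three] using hf.det_ne_zero .infX_origin_infD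
    exact this.2
  | point i j =>
    have : (a 0 ≠ 0 ∧ a 1 ≠ 0) ∧ f (point i j) 2 ≠ 0 := by
      simpa [hX, hY, Matrix.det_fin_three] using hf.det_ne_zero (.infX_infY_point i j)
    exact this.2

theorem Realizes.eq_std_of_normalized (hf : Realizes S.rankFunction f)
    (hbasis : ∀ i, f (basisVertex i) = Pi.single i 1) (hunit : f unit = 1)
    (hpivot : ∀ v, f v (pivot v) = 1) : f = std fun i => f (point i i) 0 := by
  have hX : f infX = ![1, 0, 0] := (hbasis 0).trans (by ext j; fin_cases j <;> rfl)
  have hY : f infY = ![0, 1, 0] := (hbasis 1).trans (by ext j; fin_cases j <;> rfl)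
  have hO : f origin = ![0, 0, 1] := (hbasis 2).trans (by ext j; fin_cases j <;> rfl)
  have hD₁ : f infD 1 = 1 := hpivot infD
  have hP (i j : ι) : f (point i j) 2 = 1 := hpivot (point i j)
  have hD₀ : 1 - f infD 0 = 0 := by
    simpa [hO, hunit, hD₁, Matrix.det_fin_three] using hf.det_eq_zero .diagonal_infD
  have hD₂ : f infD 2 = 0 := by
    simpa [hX, hY, Matrix.det_fin_three] using hf.det_eq_zero .infinity
  have hdiag (i : ι) : f (point i i) 1 - f (point i i) 0 = 0 := by
    simpa [hO, hunit, Matrix.det_fin_three] using hf.det_eq_zero (.diagonal i)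
  have hvert (i j : ι) : -f (point i i) 0 + f (point i j) 0 = 0 := by
    simpa [hY, hP, Matrix.det_fin_three] using hf.det_eq_zero (.vertical i j)
  have hhor (i j : ι) : f (point j j) 1 - f (point i j) 1 = 0 := by
    simpa [hX, hP, Matrix.det_fin_three] using hf.det_eq_zero (.horizontal i j)
  funext v
  cases v with
  | infX => exact hX
  | infY => exact hY
  | origin => exact hO
  | unit => exact hunit.trans (std_unit _).symm
  | infD =>
    ext k
    fin_cases k
    exacts [(sub_eq_zero.mp hD₀).symm, hD₁, hD₂]
  | point i j =>
    ext k
    fin_cases k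
    · exact (neg_add_eq_zero.mp (hvert i j)).symm
    · exact (sub_eq_zero.mp (hhor i j)).symm.trans (sub_eq_zero.mp (hdiag j))
    · exact hP i j

theorem Realizes.exists_transform_std_eq (hf : Realizes S.rankFunction f) :
    ∃ (g : (Fin 3 → K) ≃ₗ[K] (Fin 3 → K)) (c : Vertex ι → Kˣ) (t : ι → K),
      c unit = 1 ∧ S.IsSolution t ∧ transform g c (std t) = f := by
  obtain ⟨g, a, hbasis, hunit⟩ := hf.exists_linearEquiv_frame
  have hgf : Realizes S.rankFunction (g ∘ f) := by
    have h1 : transform g 1 f = g ∘ f := funext fun v => one_smul Kˣ (g (f v))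
    exact h1 ▸ (realizes_transform_iff g 1).mpr hf
  have hpivot (v : Vertex ι) : g (f v) (pivot v) ≠ 0 :=
    hgf.apply_pivot_ne_zero hbasis hunit v
  let c (v : Vertex ι) : Kˣ := Units.mk0 (g (f v) (pivot v)) (hpivot v)
  have hc : c unit = 1 := Units.ext (congrFun hunit 0)
  have hcf (v : Vertex ι) : transform g c⁻¹ f v = (g (f v) (pivot v))⁻¹ • g (f v) := rfl
  have hreal : Realizes S.rankFunction (transform g c⁻¹ f) := (realizes_transform_iff g c⁻¹).mpr hf
  have hstd := hreal.eq_std_of_normalized (fun i => ?_) ?_ fun v => ?_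
  · refine ⟨g.symm, c, _, hc, realizes_std_iff.mp (hstd ▸ hreal), ?_⟩
    rw [← hstd]
    ext1 v
    simp [transform, Units.smul_def]
  · have hai : a i ≠ 0 := by simpa [hbasis, pivot_basisVertex] using hpivot (basisVertex i)
    rw [hcf, hbasis, pivot_basisVertex, Pi.single_eq_same, ← Pi.single_smul, smul_eq_mul,
      inv_mul_cancel₀ hai]
  · rw [hcf, hunit, Pi.one_apply, inv_one, one_smul]
  · rw [hcf, Pi.smul_apply, smul_eq_mul, inv_mul_cancel₀ (hpivot v)]

variable (K S) in
/-- The realizations of `S.rankFunction` as a torsor: each solution gives one realization for every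
choice of coordinates in the plane and of representatives of the points other than `unit`, whose
representative is tied to the coordinates. -/
def realizationsEquiv :
    ((Fin 3 → K) ≃ₗ[K] (Fin 3 → K)) × {c : Vertex ι → Kˣ // c unit = 1} ×
      {t : ι → K // S.IsSolution t} ≃ {f : Vertex ι → Fin 3 → K // Realizes S.rankFunction f} :=
  Equiv.ofBijective
    (fun p => ⟨transform p.1 p.2.1 (std p.2.2.1), (realizes_transform_iff _ _).mpr
      (realizes_std_iff.mpr p.2.2.2)⟩) <| by
    refine ⟨fun ⟨g, ⟨c, hc⟩, t, ht⟩ ⟨g', ⟨c', hc'⟩, t', ht'⟩ h => ?_, fun ⟨f, hf⟩ => ?_⟩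
    · obtain ⟨rfl, rfl, rfl⟩ := transform_std_injective (hc.trans hc'.symm) (congrArg Subtype.val h)
      rfl
    · obtain ⟨g, c, t, hc, ht, rfl⟩ := hf.exists_transform_std_eq
      exact ⟨⟨g, ⟨c, hc⟩, t, ht⟩, rfl⟩

theorem card_linearEquiv_pi (n : ℕ) :
    Nat.card ((Fin n → K) ≃ₗ[K] (Fin n → K)) = Nat.card (GL (Fin n) K) :=
  Nat.card_congr (Matrix.GeneralLinearGroup.toLin.trans
    (LinearMap.GeneralLinearGroup.generalLinearEquiv K (Fin n → K))).symm.toEquiv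

theorem card_fun_apply_eq {α β : Type*} [Finite α] (a : α) (b : β) :
    Nat.card {c : α → β // c a = b} = Nat.card β ^ Nat.card {x // x ≠ a} := by
  classical
  rw [← Nat.card_fun]
  refine Nat.card_congr ((Equiv.subtypeEquivRight fun c => ?_).trans
    (Equiv.subtypePreimage (· = a) fun _ => b))
  exact ⟨fun h => funext fun ⟨x, hx⟩ => hx ▸ h, fun h => congrFun h ⟨a, rfl⟩⟩

theorem card_realizations (S : ArithSystem ι) (K : Type) [Field K] :
    Nat.card {f : Vertex ι → Fin 3 → K // Realizes S.rankFunction f} =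
      Nat.card (GL (Fin 3) K) * Nat.card Kˣ ^ Nat.card {v : Vertex ι // v ≠ unit} *
        Nat.card {t : ι → K // S.IsSolution t} := by
  rw [← Nat.card_congr (realizationsEquiv K S), Nat.card_prod, Nat.card_prod, card_linearEquiv_pi,
    card_fun_apply_eq, mul_assoc]

end Parametrization

/-! ### The factor `σ` -/

section Factor

open Polynomial

theorem X_pow_sub_X_mem_calS {n : ℕ} (hn : 1 < n) : (X ^ n - X : ℤ[X]) ∈ calS :=
  Submonoid.le_toSubmonoid_saturation (Submonoid.subset_closure ⟨n, hn, rfl⟩)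

theorem mem_calS_of_dvd {f g : ℤ[X]} (hg : g ∈ calS) (h : f ∣ g) : f ∈ calS := by
  obtain ⟨k, rfl⟩ := h
  exact (calS.mulSaturated hg).1

theorem X_mem_calS : (X : ℤ[X]) ∈ calS :=
  mem_calS_of_dvd (X_pow_sub_X_mem_calS one_lt_two) ⟨X - 1, by ring⟩

theorem X_pow_sub_one_mem_calS {n : ℕ} (hn : n ≠ 0) : (X ^ n - 1 : ℤ[X]) ∈ calS :=
  mem_calS_of_dvd (X_pow_sub_X_mem_calS (Nat.lt_add_of_pos_left (Nat.pos_of_ne_zero hn)))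
    ⟨X, by ring⟩

theorem X_sub_one_mem_calS : (X - 1 : ℤ[X]) ∈ calS := by
  simpa using X_pow_sub_one_mem_calS one_ne_zero

/-- The number of elements of the group `GL n` over a field with `q` elements, as a polynomial in
`q`. -/
def glPolynomial (n : ℕ) : ℤ[X] :=
  ∏ i : Fin n, (X ^ n - X ^ (i : ℕ))

theorem glPolynomial_mem_calS (n : ℕ) : glPolynomial n ∈ calS := by
  refine prod_mem fun i _ => ?_
  have h : (X ^ n - X ^ (i : ℕ) : ℤ[X]) = X ^ (i : ℕ) * (X ^ (n - i) - 1) := by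
    rw [mul_sub, mul_one, pow_mul_pow_sub X i.2.le]
  rw [h]
  exact mul_mem (pow_mem X_mem_calS i) (X_pow_sub_one_mem_calS (Nat.sub_ne_zero_of_lt i.2))

theorem polyFun_glPolynomial (n : ℕ) (q : PrimePower) :
    polyFun (glPolynomial n) q = Nat.card (GL (Fin n) (FF q)) := by
  have := Fintype.ofFinite (FF q)
  rw [Matrix.card_GL_field, ← Nat.card_eq_fintype_card, card_FF, polyFun, glPolynomial, eval_prod,
    Nat.cast_prod]
  refine Finset.prod_congr rfl fun i _ => ?_
  rw [Nat.cast_sub (Nat.pow_le_pow_right q.2.pos i.2.le)]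
  simp

theorem polyFun_X_sub_one (q : PrimePower) : polyFun (X - 1) q = Nat.card (FF q)ˣ := by
  rw [Nat.card_units, card_FF, Nat.cast_sub q.2.pos]
  simp [polyFun]

theorem polyFun_mul (f g : ℤ[X]) : polyFun (f * g) = polyFun f * polyFun g :=
  funext fun _ => eval_mul

theorem polyFun_pow (f : ℤ[X]) (n : ℕ) : polyFun (f ^ n) = polyFun f ^ n :=
  funext fun _ => eval_pow n

end Factor

end MnevSturmfels

end

theorem mainTheorem5_general (X : AlgebraicGeometry.Scheme.{0})
    (hft : MnevSturmfels.IsFiniteTypeOverInt X) :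
    ∃ (V : Type) (_ : Finite V) (π : MnevSturmfels.PartialRankFunction V),
      ∃ σ ∈ MnevSturmfels.calS,
        MnevSturmfels.polyFun σ * MnevSturmfels.pointCount X =
          MnevSturmfels.pointCount (MnevSturmfels.L 3 π) := by
  open MnevSturmfels in
  obtain ⟨B, _, _, hB⟩ := exists_finiteType_ring_points hft
  obtain ⟨ι, _, S, hS⟩ := exists_arithSystem B
  let N := Nat.card {v : Vertex ι // v ≠ .unit}
  refine ⟨Vertex ι, inferInstance, S.rankFunction, glPolynomial 3 * (Polynomial.X - 1) ^ N,
    mul_mem (glPolynomial_mem_calS 3) (pow_mem X_sub_one_mem_calS N), funext fun q => ?_⟩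
  obtain ⟨pointsX⟩ := hB (FF q)
  obtain ⟨solutions⟩ := hS (FF q)
  have hX : pointCount X q = Nat.card {t : ι → FF q // S.IsSolution t} :=
    congrArg Nat.cast (Nat.card_congr (pointsX.trans solutions))
  have hL : pointCount (L 3 S.rankFunction) q =
      ((Nat.card (GL (Fin 3) (FF q)) * Nat.card (FF q)ˣ ^ N *
        Nat.card {t : ι → FF q // S.IsSolution t} : ℕ) : ℤ) := by
    rw [pointCount, Nat.card_congr (pointsLEquiv (FF q) 3 S.rankFunction), card_realizations]
  rw [Pi.mul_apply, polyFun_mul, polyFun_pow, Pi.mul_apply, Pi.pow_apply, polyFun_glPolynomial,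
    polyFun_X_sub_one, hX, hL]
  push_cast
  rfl

theorem mainTheorem5 (X : AlgebraicGeometry.Scheme.{0})
    (hft : MnevSturmfels.IsFiniteTypeOverInt X)
    (hqp : MnevSturmfels.IsQuasiProjectiveOverInt X) :
    ∃ (V : Type) (_ : Finite V) (π : MnevSturmfels.PartialRankFunction V),
      ∃ σ ∈ MnevSturmfels.calS,
        MnevSturmfels.polyFun σ * MnevSturmfels.pointCount X =
          MnevSturmfels.pointCount (MnevSturmfels.L 3 π) :=
  mainTheorem5_general X hft
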